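/- Let $n\ge 1$ be an integer and let $d\mu_n=(1-t^2)^{(n-2)/2}\,dt$ on $[-1,1]$. For $k\ge 0$ let $\varphi_{n,k}$ be the Gegenbauer polynomial of degree $k$ associated with the sphere $S^n\subset\mathbb R^{n+1}$, normalized by $\varphi_{n,k}(1)=\alpha_{n,k}/\operatorname{vol}(S^n)$; that is, $\varphi_{n,k}=\frac{\alpha_{n,k}}{\operatorname{vol}(S^n)}P_{n,k}$, where $P_{n,0}=1$, $P_{n,1}=t$, $(k+n)P_{n,k+2}=(2k+n+1)\,t\,P_{n,k+1}-(k+1)P_{n,k}$ for $k\ge 0$ (so the $\varphi_{n,k}$ are orthogonal in $\mathscr L^2(\mu_n)$), and $\alpha_{n,k}$ is the dimension of the space of spherical harmonics of degree $k$ on $S^n$: $\alpha_{n,0}=1$, $\alpha_{n,1}=n+1$, $\alpha_{n,k}=\binom{n+k}{k}-\binom{n+k-2}{k-2}$ for $k\ge 2$. Let $\theta:[-1,1]\to\mathbb R$ be $C^2$ and let $(a_k)_{k\ge0}$ be real numbers with $\theta=\lim_{K\to\infty}\sum_{k=0}^K a_k\varphi_{n,k}$ in $\mathscr L^2(\mu_n)$.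 Then the functions $$g_\theta(t)=\lim_{K\to\infty}\sum_{k=0}^K a_k^2\varphi_{n,k}(t),\qquad h_\theta(t)=\lim_{K\to\infty}\sum_{k=0}^K a_k^2\varphi_{n,k}'(t)$$ are well defined on $[-1,1]$: both series converge absolutely at every $t\in[-1,1]$, and they converge to $g_\theta$ and $h_\theta$ in $\mathscr L^2(\mu_n)$ as well. If moreover $\theta$ is $C^4$ on $[-1,1]$, then $g_\theta'(t)=h_\theta(t)$ for all $t\in[-1,1]$ (in particular $g_\theta$ is differentiable there; derivatives at $t=\pm1$ are one-sided). -/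

import Mathlib

open MeasureTheory Filter Topology Polynomial

noncomputable section

/-- The Gegenbauer (ultraspherical) polynomial of degree `k` attached to the sphere `S^n`
(ambient dimension `n + 1`), normalized to take the value `1` at `t = 1`, given by the classical
three-term recurrence
`(k + n) P_{k+2} = (2 k + n + 1) t P_{k+1} - (k + 1) P_k`, `P_0 = 1`, `P_1 = t`.
For `n = 1` these are the Chebyshev polynomials `T_k`, for `n = 2` the Legendre polynomials, and
for `n ≥ 2` they are `C_k^{(λ)} / C_k^{(λ)}(1)` with `λ = (n - 1) / 2`. -/
def gegenbauerP (n : ℕ) : ℕ → ℝ[X]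
  | 0 => 1
  | 1 => X
  | k + 2 => C (1 / ((k : ℝ) + n)) *
      (C (2 * (k : ℝ) + n + 1) * X * gegenbauerP n (k + 1) - C ((k : ℝ) + 1) * gegenbauerP n k)

/-- The dimension `α_{n,k}` of the space of spherical harmonics of degree `k` on `S^n`:
`1` for `k = 0`, `n + 1` for `k = 1`, and `binom(n+k,k) - binom(n+k-2,k-2)` for `k ≥ 2`. -/
def harmonicDim (n : ℕ) : ℕ → ℝ
  | 0 => 1
  | 1 => (n : ℝ) + 1
  | k + 2 => ((n + (k + 2)).choose (k + 2) : ℝ) - ((n + k).choose k : ℝ)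

/-- The `n`-dimensional volume of the unit sphere `S^n` of `ℝ^{n+1}`. -/
def sphereVol (n : ℕ) : ℝ :=
  (volume : Measure (EuclideanSpace ℝ (Fin (n + 1)))).toSphere.real Set.univ

/-- The Gegenbauer polynomial `φ_{n,k}`, in the normalization
`φ_{n,k}(1) = α_{n,k} / vol(S^n)`. -/
def gegenbauerPhi (n k : ℕ) : ℝ[X] :=
  C (harmonicDim n k / sphereVol n) * gegenbauerP n k

/-- The measure `dμ_n = (1 - t^2)^{(n-2)/2} dt` on `[-1, 1]`. -/
def gegenbauerMeasure (n : ℕ) : Measure ℝ :=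
  (volume.restrict (Set.Icc (-1 : ℝ) 1)).withDensity
    fun t => ENNReal.ofReal ((1 - t ^ 2) ^ (((n : ℝ) - 2) / 2))

/-- `g(t) = ∑ a_k² φ_{n,k}(t)`. -/
def gTheta (n : ℕ) (a : ℕ → ℝ) (t : ℝ) : ℝ :=
  ∑' k, a k ^ 2 * (gegenbauerPhi n k).eval t

/-- `h(t) = ∑ a_k² φ_{n,k}'(t)`. -/
def hTheta (n : ℕ) (a : ℕ → ℝ) (t : ℝ) : ℝ :=
  ∑' k, a k ^ 2 * (derivative (gegenbauerPhi n k)).eval t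

end

/-!
Write `P_k` for `gegenbauerP n k`, `α_k` for `harmonicDim n k`, `V` for the volume of `S^n` and
`λ_k = k (k + n - 1)`. Everything follows from the Weierstrass test with the single majorant
`a_k² (α_k / V) (1 + λ_k²)`.

The three-term recurrence implies the differential equation `L P_k = -λ_k P_k` with
`L u = (1 - t²) u'' - n t u'` (`gegenbauerP_ode`). Sonin's monotonicity argument
(`abs_eval_le_of_ode`), applied to `P_k` and to `P_k'`, which solves an equation of the same type,
shows that both are bounded on `[-1, 1]` by their values at `1`, that is `|P_k| ≤ 1` and
`|P_k'| ≤ λ_k / n`. So the majorant does dominate both series.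

Its summability is Bessel's inequality. The operator `L` is symmetric in `L²(μ_n)`
(`integral_gegenbauerOp_mul_comm`), hence the `P_k` are orthogonal, and the recurrence gives
`α_k ‖P_k‖² = μ_n([-1, 1])` for all `k` (`harmonicDim_mul_integral_gegenbauerP_sq`). Therefore
`⟨θ, P_k⟩` is `a_k / V` up to a constant factor not depending on `k`, and for `θ` of class `C²`
also `⟨L θ, P_k⟩ = -λ_k ⟨θ, P_k⟩`. Bessel's inequality for `θ` and for `L θ` bounds
`∑ a_k² α_k` and `∑ a_k² α_k λ_k²`.

Convergence of both series is thus absolute and uniform on `[-1, 1]`, which gives convergence in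
`L²` of the finite measure `μ_n` and allows differentiation term by term.
-/

/-! ### The Gegenbauer differential equation -/

theorem gegenbauerP_zero (n : ℕ) : gegenbauerP n 0 = 1 := rfl

theorem gegenbauerP_one (n : ℕ) : gegenbauerP n 1 = X := rfl

theorem gegenbauerP_add_two {n : ℕ} (hn : 1 ≤ n) (k : ℕ) :
    ((k : ℝ[X]) + (n : ℝ[X])) * gegenbauerP n (k + 2) =
      (2 * (k : ℝ[X]) + (n : ℝ[X]) + 1) * X * gegenbauerP n (k + 1)
        - ((k : ℝ[X]) + 1) * gegenbauerP n k := by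
  have hne : (k : ℝ) + n ≠ 0 := by positivity
  have hC : ((k : ℝ[X]) + (n : ℝ[X])) * C (1 / ((k : ℝ) + n)) = 1 := by
    have : ((k : ℝ[X]) + (n : ℝ[X])) = C ((k : ℝ) + n) := by simp
    rw [this, ← C_mul, mul_one_div_cancel hne, C_1]
  rw [gegenbauerP, ← mul_assoc, hC, one_mul]
  have h2 : (C 2 : ℝ[X]) = 2 := map_ofNat C 2
  simp only [C_add, C_mul, C_1, h2, map_natCast]

/-- The derivative of `P_{k+1}` in terms of `P_{k+1}` and `P_k`. The induction works because, given
the recurrence, the relation for `P_{k+1}'` is equivalent to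
`(1 - t²) P_k' = (k + n - 1) (t P_k - P_{k+1})` with `k` raised by one. -/
theorem one_sub_sq_mul_derivative_gegenbauerP {n : ℕ} (hn : 1 ≤ n) (k : ℕ) :
    (1 - X ^ 2) * derivative (gegenbauerP n (k + 1)) =
      ((k : ℝ[X]) + 1) * (gegenbauerP n k - X * gegenbauerP n (k + 1)) := by
  induction k using Nat.twoStepInduction with
  | zero => simp [gegenbauerP]; ring
  | one =>
    have hne : (((0 : ℕ) : ℝ[X]) + (n : ℝ[X])) ≠ 0 := by
      have : n ≠ 0 := by omega
      simpa using this
    refine mul_left_cancel₀ hne ?_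
    have h := gegenbauerP_add_two hn 0
    have hd := congrArg derivative h
    simp [gegenbauerP_zero, gegenbauerP_one, derivative_mul, -mul_eq_mul_left_iff] at h hd ⊢
    linear_combination (1 - X ^ 2) * hd + 2 * X * h
  | more k ih₁ ih₂ =>
    have hne : (((k + 1 : ℕ) : ℝ[X]) + (n : ℝ[X])) ≠ 0 := by
      have : k + 1 + n ≠ 0 := by omega
      exact_mod_cast this
    refine mul_left_cancel₀ hne ?_
    have h₀ := gegenbauerP_add_two hn k
    have h := gegenbauerP_add_two hn (k + 1)
    have hd := congrArg derivative h
    simp [derivative_mul, -mul_eq_mul_left_iff] at h hd ih₁ ih₂ ⊢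
    linear_combination (1 - X ^ 2) * hd + (2 * (k + 1) + n + 1) * X * ih₂ - (k + 2) * ih₁
      + (k + 3) * X * h - (k+2) * h₀

/-- The Gegenbauer differential equation `(1 - t²) P'' - n t P' + k (k + n - 1) P = 0`. -/
theorem gegenbauerP_ode {n : ℕ} (hn : 1 ≤ n) (k : ℕ) :
    (1 - X ^ 2) * derivative (derivative (gegenbauerP n k))
      - (n : ℝ[X]) * X * derivative (gegenbauerP n k)
      + (k : ℝ[X]) * ((k : ℝ[X]) + (n : ℝ[X]) - 1) * gegenbauerP n k = 0 := by
  rcases k with _ | _ | k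
  · simp [gegenbauerP]
  · simp [gegenbauerP]
  have hne : (1 - X ^ 2 : ℝ[X]) ≠ 0 := by
    intro h
    have := congrArg (eval 0) h
    simp at this
  refine mul_left_cancel₀ hne ?_
  have h₀ := gegenbauerP_add_two hn k
  have h₁ := one_sub_sq_mul_derivative_gegenbauerP hn k
  have h₂ := one_sub_sq_mul_derivative_gegenbauerP hn (k + 1)
  have hd := congrArg derivative h₂
  simp [derivative_mul, -mul_eq_mul_left_iff, -mul_eq_zero] at h₁ h₂ hd ⊢
  linear_combination (1 - X ^ 2) * hd + (k + 2) * h₁ + (2 - n - k - 2) * X * h₂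
    + (k + 2) * h₀

theorem gegenbauerP_eval_one {n : ℕ} (hn : 1 ≤ n) (k : ℕ) : (gegenbauerP n k).eval 1 = 1 := by
  induction k using Nat.twoStepInduction with
  | zero => simp [gegenbauerP]
  | one => simp [gegenbauerP]
  | more k ih₁ ih₂ =>
    have h := congrArg (eval 1) (gegenbauerP_add_two hn k)
    have hne : (k : ℝ) + n ≠ 0 := by positivity
    refine mul_left_cancel₀ hne ?_
    simp [ih₁, ih₂] at h
    linear_combination h

theorem gegenbauerP_eval_neg_one {n : ℕ} (hn : 1 ≤ n) (k : ℕ) :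
    (gegenbauerP n k).eval (-1) = (-1) ^ k := by
  induction k using Nat.twoStepInduction with
  | zero => simp [gegenbauerP]
  | one => simp [gegenbauerP]
  | more k ih₁ ih₂ =>
    have h := congrArg (eval (-1)) (gegenbauerP_add_two hn k)
    have hne : (k : ℝ) + n ≠ 0 := by positivity
    refine mul_left_cancel₀ hne ?_
    simp [ih₁, ih₂] at h
    rw [h]; ring

/-! ### Pointwise bounds on `[-1, 1]` -/

/-- Sonin's argument: `q² + (1 - t²) q'² / c` has derivative `2 (m - 1) t q'² / c`, so it is largest
at the endpoints, where it agrees with `q²`. -/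
theorem abs_eval_le_of_ode {q : ℝ[X]} {m c B : ℝ} (hm : 1 ≤ m) (hc : 0 < c)
    (hode : ∀ t : ℝ, (1 - t ^ 2) * (derivative (derivative q)).eval t
      - m * t * (derivative q).eval t + c * q.eval t = 0)
    (h1 : |q.eval 1| ≤ B) (h2 : |q.eval (-1)| ≤ B) {t : ℝ} (ht : t ∈ Set.Icc (-1 : ℝ) 1) :
    |q.eval t| ≤ B := by
  have hB : 0 ≤ B := (abs_nonneg _).trans h1
  set F : ℝ[X] := C c * q ^ 2 + (1 - X ^ 2) * (derivative q) ^ 2 with hF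
  have hF' : ∀ s : ℝ, (derivative F).eval s = 2 * (m - 1) * s * (derivative q).eval s ^ 2 := by
    intro s
    simp [hF, derivative_mul, derivative_pow]
    linear_combination 2 * (derivative q).eval s * hode s
  have hFt : ∀ s : ℝ, F.eval s = c * q.eval s ^ 2 + (1 - s ^ 2) * (derivative q).eval s ^ 2 := by
    intro s; simp [hF]
  have key : F.eval t ≤ c * B ^ 2 := by
    rcases le_total 0 t with h0 | h0
    · have hmono : MonotoneOn (fun s => F.eval s) (Set.Icc 0 1) := by
        refine monotoneOn_of_deriv_nonneg (convex_Icc _ _) F.continuousOn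
          F.differentiable.differentiableOn fun s hs => ?_
        rw [interior_Icc] at hs
        rw [Polynomial.deriv, hF']
        have := hs.1.le
        have : 0 ≤ m - 1 := by linarith
        positivity
      have h := hmono ⟨h0, ht.2⟩ ⟨zero_le_one, le_rfl⟩ ht.2
      simp only [hFt 1] at h
      have : q.eval 1 ^ 2 ≤ B ^ 2 := sq_le_sq' (abs_le.mp h1).1 (abs_le.mp h1).2
      nlinarith
    · have hanti : AntitoneOn (fun s => F.eval s) (Set.Icc (-1) 0) := by
        refine antitoneOn_of_deriv_nonpos (convex_Icc _ _) F.continuousOn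
          F.differentiable.differentiableOn fun s hs => ?_
        rw [interior_Icc] at hs
        rw [Polynomial.deriv, hF']
        have h3 : 0 ≤ m - 1 := by linarith
        have h4 : 0 ≤ 2 * (m - 1) * (derivative q).eval s ^ 2 := by positivity
        nlinarith [hs.2]
      have h := hanti ⟨le_rfl, by norm_num⟩ ⟨ht.1, h0⟩ ht.1
      simp only [hFt (-1)] at h
      have : q.eval (-1) ^ 2 ≤ B ^ 2 := sq_le_sq' (abs_le.mp h2).1 (abs_le.mp h2).2
      nlinarith
  rw [hFt] at key
  have h5 : 0 ≤ (1 - t ^ 2) * (derivative q).eval t ^ 2 :=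
    mul_nonneg (by nlinarith [ht.1, ht.2]) (sq_nonneg _)
  have h6 : q.eval t ^ 2 ≤ B ^ 2 := le_of_mul_le_mul_left (by linarith) hc
  exact abs_le_of_sq_le_sq h6 hB

theorem gegenbauerP_ode_eval {n : ℕ} (hn : 1 ≤ n) (k : ℕ) (t : ℝ) :
    (1 - t ^ 2) * (derivative (derivative (gegenbauerP n k))).eval t
      - n * t * (derivative (gegenbauerP n k)).eval t
      + (k : ℝ) * (k + n - 1) * (gegenbauerP n k).eval t = 0 := by
  simpa using congrArg (eval t) (gegenbauerP_ode hn k)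

theorem abs_gegenbauerP_le_one {n : ℕ} (hn : 1 ≤ n) (k : ℕ) {t : ℝ}
    (ht : t ∈ Set.Icc (-1 : ℝ) 1) : |(gegenbauerP n k).eval t| ≤ 1 := by
  rcases k with _ | k
  · simp [gegenbauerP]
  have hn' : (1 : ℝ) ≤ n := by exact_mod_cast hn
  refine abs_eval_le_of_ode hn' ?_ (gegenbauerP_ode_eval hn (k + 1)) ?_ ?_ ht
  · push_cast
    have : (0 : ℝ) ≤ k := k.cast_nonneg
    have : (0 : ℝ) < k + 1 + n - 1 := by linarith
    positivity
  · simp [gegenbauerP_eval_one hn]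
  · simp [gegenbauerP_eval_neg_one hn]

/-- The derivative of `P` solves the differential equation with `n + 2` in place of `n`, and the
equation for `P` at `t = ±1` gives the endpoint values of `P'`. -/
theorem abs_derivative_gegenbauerP_le {n : ℕ} (hn : 1 ≤ n) (k : ℕ) {t : ℝ}
    (ht : t ∈ Set.Icc (-1 : ℝ) 1) :
    |(derivative (gegenbauerP n k)).eval t| ≤ (k : ℝ) * (k + n - 1) / n := by
  have hn' : (1 : ℝ) ≤ n := by exact_mod_cast hn
  have hn0 : (0 : ℝ) < n := by linarith
  rcases k with _ | _ | k
  · simp [gegenbauerP]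
  · simp [gegenbauerP, hn0.ne']
  have hk : (0 : ℝ) ≤ k := k.cast_nonneg
  have hend : 0 ≤ ((k + 2 : ℕ) : ℝ) * ((k + 2 : ℕ) + n - 1) / n := by
    push_cast
    have : (0 : ℝ) ≤ k + 2 + n - 1 := by linarith
    positivity
  refine abs_eval_le_of_ode (m := n + 2) (c := (k + 1) * (k + 2 + n)) (by linarith)
    (by positivity) (fun s => ?_) ?_ ?_ ht
  · have h := congrArg (fun q => eval s (derivative q)) (gegenbauerP_ode hn (k + 2))
    simp [derivative_mul] at h
    linear_combination h
  · have h := gegenbauerP_ode_eval hn (k + 2) 1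
    rw [gegenbauerP_eval_one hn] at h
    have h' : (derivative (gegenbauerP n (k + 2))).eval 1
        = ((k + 2 : ℕ) : ℝ) * ((k + 2 : ℕ) + n - 1) / n := by
      rw [eq_div_iff hn0.ne']; linear_combination -h
    rw [h', abs_of_nonneg hend]
  · have h := gegenbauerP_ode_eval hn (k + 2) (-1)
    rw [gegenbauerP_eval_neg_one hn] at h
    have h' : (derivative (gegenbauerP n (k + 2))).eval (-1)
        = -(((k + 2 : ℕ) : ℝ) * ((k + 2 : ℕ) + n - 1) / n) * (-1) ^ (k + 2) := by
      rw [neg_mul, div_mul_eq_mul_div, ← neg_div, eq_div_iff hn0.ne']; linear_combination h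
    rw [h', abs_mul, abs_neg, abs_of_nonneg hend, abs_pow, abs_neg, abs_one, one_pow, mul_one]

/-! ### Dimensions of spaces of spherical harmonics -/

theorem harmonicDim_add_two_mul (n k : ℕ) :
    harmonicDim n (k + 2) * ((k + 2) * (k + 1)) = (n + k).choose k * n * (n + 2 * k + 3) := by
  have h₁ : ((n + k + 1 : ℕ) : ℝ) * (n + k).choose k
      = (n + k + 1).choose (k + 1) * (k + 1 : ℕ) := by
    exact_mod_cast Nat.add_one_mul_choose_eq (n + k) k
  have h₂ : ((n + k + 1 + 1 : ℕ) : ℝ) * (n + k + 1).choose (k + 1)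
      = (n + k + 1 + 1).choose (k + 1 + 1) * (k + 1 + 1 : ℕ) := by
    exact_mod_cast Nat.add_one_mul_choose_eq (n + k + 1) (k + 1)
  rw [harmonicDim]
  have e : n + (k + 2) = n + k + 1 + 1 := by ring
  rw [e]
  push_cast at h₁ h₂ ⊢
  linear_combination -(k + 1 : ℝ) * h₂ - (n + k + 2 : ℝ) * h₁

/-- Multiplied by `n + k`, the formula also covers degree one, where `harmonicDim` is not given by
a difference of binomial coefficients. -/
theorem harmonicDim_add_one_mul (n k : ℕ) :
    harmonicDim n (k + 1) * ((k + 1) * (n + k)) = (n + k).choose k * n * (n + 2 * k + 1) := by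
  rcases k with _ | k
  · simp [harmonicDim]; ring
  have h := harmonicDim_add_two_mul n k
  have h₁ : ((n + k + 1 : ℕ) : ℝ) * (n + k).choose k
      = (n + k + 1).choose (k + 1) * (k + 1 : ℕ) := by
    exact_mod_cast Nat.add_one_mul_choose_eq (n + k) k
  have hk : (k : ℝ) + 1 ≠ 0 := by positivity
  refine mul_left_cancel₀ hk ?_
  have e : n + (k + 1) = n + k + 1 := by ring
  rw [e]
  push_cast at h₁ h ⊢
  linear_combination (n + k + 1 : ℝ) * h + (n : ℝ) * (n + 2 * k + 3) * h₁

/-- The ratio of consecutive dimensions of spaces of spherical harmonics. -/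
theorem harmonicDim_ratio (n k : ℕ) :
    harmonicDim n (k + 2) * ((k + 2) * (2 * k + n + 1))
      = harmonicDim n (k + 1) * ((2 * k + n + 3) * (k + n)) := by
  have hk : (k : ℝ) + 1 ≠ 0 := by positivity
  refine mul_left_cancel₀ hk ?_
  linear_combination (2 * k + n + 1 : ℝ) * harmonicDim_add_two_mul n k
    - (2 * k + n + 3 : ℝ) * harmonicDim_add_one_mul n k

/-! ### The Gegenbauer measure -/

/-- The exponent is at least `-1/2`, so the density is dominated by the derivative of `arcsin`. -/
theorem integrableOn_gegenbauerWeight {n : ℕ} (hn : 1 ≤ n) :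
    IntegrableOn (fun t : ℝ => (1 - t ^ 2) ^ (((n : ℝ) - 2) / 2)) (Set.Icc (-1) 1) := by
  have harc : IntegrableOn (fun t : ℝ => 1 / √(1 - t ^ 2)) (Set.Ioc (-1) 1) :=
    intervalIntegral.integrableOn_deriv_of_nonneg Real.continuous_arcsin.continuousOn
      (fun t ht => Real.hasDerivAt_arcsin ht.1.ne' ht.2.ne) fun t _ => by positivity
  rw [integrableOn_Icc_iff_integrableOn_Ioo]
  rw [integrableOn_Ioc_iff_integrableOn_Ioo] at harc
  have hmeas : Measurable fun t : ℝ => (1 - t ^ 2) ^ (((n : ℝ) - 2) / 2) := by fun_prop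
  refine Integrable.mono' harc hmeas.aestronglyMeasurable ?_
  refine (ae_restrict_iff' measurableSet_Ioo).mpr (Eventually.of_forall fun t ht => ?_)
  have h0 : 0 < 1 - t ^ 2 := by nlinarith [ht.1, ht.2]
  have h1 : 1 - t ^ 2 ≤ 1 := by nlinarith [sq_nonneg t]
  have hn' : (1 : ℝ) ≤ n := by exact_mod_cast hn
  rw [Real.norm_of_nonneg (Real.rpow_nonneg h0.le _), Real.sqrt_eq_rpow, one_div,
    ← Real.rpow_neg h0.le]
  exact Real.rpow_le_rpow_of_exponent_ge h0 h1 (by linarith)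

theorem isFiniteMeasure_gegenbauerMeasure {n : ℕ} (hn : 1 ≤ n) :
    IsFiniteMeasure (gegenbauerMeasure n) :=
  isFiniteMeasure_withDensity_ofReal (integrableOn_gegenbauerWeight hn).2

theorem ae_mem_Icc_gegenbauerMeasure (n : ℕ) :
    ∀ᵐ t ∂gegenbauerMeasure n, t ∈ Set.Icc (-1 : ℝ) 1 :=
  (withDensity_absolutelyContinuous _ _).ae_le (ae_restrict_mem measurableSet_Icc)

theorem integral_gegenbauerMeasure (n : ℕ) (f : ℝ → ℝ) :
    ∫ t, f t ∂gegenbauerMeasure n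
      = ∫ t in (-1)..1, (1 - t ^ 2) ^ (((n : ℝ) - 2) / 2) * f t := by
  rw [gegenbauerMeasure, integral_withDensity_eq_integral_toReal_smul (by fun_prop) (by simp),
    intervalIntegral.integral_of_le (by norm_num), ← integral_Icc_eq_integral_Ioc]
  refine setIntegral_congr_fun measurableSet_Icc fun t ht => ?_
  have h0 : 0 ≤ 1 - t ^ 2 := by nlinarith [ht.1, ht.2]
  simp [ENNReal.toReal_ofReal (Real.rpow_nonneg h0 _)]

theorem ContinuousOn.memLp_gegenbauerMeasure {n : ℕ} (hn : 1 ≤ n) {f : ℝ → ℝ}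
    (hf : ContinuousOn f (Set.Icc (-1) 1)) (p : ENNReal) : MemLp f p (gegenbauerMeasure n) := by
  have := isFiniteMeasure_gegenbauerMeasure hn
  obtain ⟨B, hB⟩ := isCompact_Icc.exists_bound_of_continuousOn hf
  exact MemLp.of_bound ((hf.aestronglyMeasurable measurableSet_Icc).mono_ac
    (withDensity_absolutelyContinuous _ _)) B ((ae_mem_Icc_gegenbauerMeasure n).mono hB)

theorem integrable_eval_gegenbauerMeasure {n : ℕ} (hn : 1 ≤ n) (p : ℝ[X]) :
    Integrable (fun t => p.eval t) (gegenbauerMeasure n) :=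
  memLp_one_iff_integrable.mp (p.continuousOn.memLp_gegenbauerMeasure hn 1)

theorem gegenbauerMeasure_real_univ_pos {n : ℕ} (hn : 1 ≤ n) :
    0 < (gegenbauerMeasure n).real Set.univ := by
  have h := integral_gegenbauerMeasure n fun _ => 1
  simp only [integral_const, smul_eq_mul, mul_one] at h
  rw [h]
  refine intervalIntegral.intervalIntegral_pos_of_pos_on ?_ (fun t ht => ?_) (by norm_num)
  · rw [intervalIntegrable_iff_integrableOn_Icc_of_le (by norm_num)]
    exact integrableOn_gegenbauerWeight hn
  · exact Real.rpow_pos_of_pos (by nlinarith [ht.1, ht.2]) _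

/-! ### Symmetry of the Gegenbauer operator, orthogonality and norms -/

/-- The operator `L u = (1 - t²) u'' - n t u'` is symmetric in `L²(μ_n)`: with `w` the density of
`μ_n`, the product `w (v L u - u L v)` is the derivative of `(1 - t²)^{n/2} (u' v - u v')`, which
vanishes at `t = ±1`. -/
theorem integral_gegenbauerOp_mul_comm {n : ℕ} (hn : 1 ≤ n) {u u' u'' v v' v'' : ℝ → ℝ}
    (hu : ContinuousOn u (Set.Icc (-1) 1)) (hu' : ContinuousOn u' (Set.Icc (-1) 1))
    (hu'' : ContinuousOn u'' (Set.Icc (-1) 1))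
    (hv : ContinuousOn v (Set.Icc (-1) 1)) (hv' : ContinuousOn v' (Set.Icc (-1) 1))
    (hv'' : ContinuousOn v'' (Set.Icc (-1) 1))
    (hdu : ∀ t ∈ Set.Ioo (-1 : ℝ) 1, HasDerivAt u (u' t) t)
    (hdu' : ∀ t ∈ Set.Ioo (-1 : ℝ) 1, HasDerivAt u' (u'' t) t)
    (hdv : ∀ t ∈ Set.Ioo (-1 : ℝ) 1, HasDerivAt v (v' t) t)
    (hdv' : ∀ t ∈ Set.Ioo (-1 : ℝ) 1, HasDerivAt v' (v'' t) t) :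
    ∫ t, ((1 - t ^ 2) * u'' t - n * t * u' t) * v t ∂gegenbauerMeasure n
      = ∫ t, u t * ((1 - t ^ 2) * v'' t - n * t * v' t) ∂gegenbauerMeasure n := by
  have hn' : (1 : ℝ) ≤ n := by exact_mod_cast hn
  have hcl : ContinuousOn (fun t => ((1 - t ^ 2) * u'' t - n * t * u' t) * v t)
      (Set.Icc (-1) 1) := by fun_prop
  have hcr : ContinuousOn (fun t => u t * ((1 - t ^ 2) * v'' t - n * t * v' t))
      (Set.Icc (-1) 1) := by fun_prop
  rw [← sub_eq_zero, ← integral_sub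
    (memLp_one_iff_integrable.mp (hcl.memLp_gegenbauerMeasure hn 1))
    (memLp_one_iff_integrable.mp (hcr.memLp_gegenbauerMeasure hn 1)), integral_gegenbauerMeasure,
    intervalIntegral.integral_eq_sub_of_hasDerivAt_of_le
      (f := fun t => (1 - t ^ 2) ^ ((n : ℝ) / 2) * (u' t * v t - u t * v' t)) (by norm_num)]
  · have h0 : (n : ℝ) / 2 ≠ 0 := by positivity
    simp [Real.zero_rpow h0]
  · refine ContinuousOn.mul ?_ (by fun_prop)
    exact ContinuousOn.rpow_const (by fun_prop) fun _ _ => Or.inr (by positivity)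
  · intro t ht
    have hpos : 0 < 1 - t ^ 2 := by nlinarith [ht.1, ht.2]
    have h1 : HasDerivAt (fun t : ℝ => 1 - t ^ 2) (-(2 * t)) t := by
      simpa using (hasDerivAt_pow 2 t).const_sub 1
    have h2 := (h1.rpow_const (p := (n : ℝ) / 2) (Or.inl hpos.ne')).mul
      (((hdu' t ht).mul (hdv t ht)).sub ((hdu t ht).mul (hdv' t ht)))
    convert! h2 using 1
    have e1 : (n : ℝ) / 2 - 1 = ((n : ℝ) - 2) / 2 := by ring
    have e2 : (1 - t ^ 2) ^ ((n : ℝ) / 2) = (1 - t ^ 2) ^ (((n : ℝ) - 2) / 2) * (1 - t ^ 2) := by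
      rw [← Real.rpow_add_one hpos.ne']
      congr 1
      ring
    simp only [Pi.mul_apply, Pi.sub_apply]
    rw [e1, e2]
    ring
  · refine IntervalIntegrable.mul_continuousOn ?_ ?_
    · rw [intervalIntegrable_iff_integrableOn_Icc_of_le (by norm_num)]
      exact integrableOn_gegenbauerWeight hn
    · rw [Set.uIcc_of_le (by norm_num)]
      exact hcl.sub hcr

/-- Moving the operator `L` onto `P_k`, of which it is an eigenvector. -/
theorem integral_gegenbauerOp_mul_gegenbauerP {n : ℕ} (hn : 1 ≤ n) (k : ℕ) {u u' u'' : ℝ → ℝ}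
    (hu : ContinuousOn u (Set.Icc (-1) 1)) (hu' : ContinuousOn u' (Set.Icc (-1) 1))
    (hu'' : ContinuousOn u'' (Set.Icc (-1) 1))
    (hdu : ∀ t ∈ Set.Ioo (-1 : ℝ) 1, HasDerivAt u (u' t) t)
    (hdu' : ∀ t ∈ Set.Ioo (-1 : ℝ) 1, HasDerivAt u' (u'' t) t) :
    ∫ t, ((1 - t ^ 2) * u'' t - n * t * u' t) * (gegenbauerP n k).eval t ∂gegenbauerMeasure n
      = -((k : ℝ) * (k + n - 1)) * ∫ t, u t * (gegenbauerP n k).eval t ∂gegenbauerMeasure n := by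
  rw [integral_gegenbauerOp_mul_comm hn hu hu' hu'' (gegenbauerP n k).continuousOn
    (derivative (gegenbauerP n k)).continuousOn
    (derivative (derivative (gegenbauerP n k))).continuousOn hdu hdu'
    (fun t _ => (gegenbauerP n k).hasDerivAt t)
    (fun t _ => (derivative (gegenbauerP n k)).hasDerivAt t), ← integral_const_mul]
  congr 1 with t
  linear_combination u t * gegenbauerP_ode_eval hn k t

/-- Eigenvectors of a symmetric operator for distinct eigenvalues are orthogonal. -/
theorem integral_gegenbauerP_mul_of_ne {n : ℕ} (hn : 1 ≤ n) {j k : ℕ} (hjk : j ≠ k) :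
    ∫ t, (gegenbauerP n j).eval t * (gegenbauerP n k).eval t ∂gegenbauerMeasure n = 0 := by
  have h := integral_gegenbauerOp_mul_gegenbauerP hn k (gegenbauerP n j).continuousOn
    (derivative (gegenbauerP n j)).continuousOn
    (derivative (derivative (gegenbauerP n j))).continuousOn
    (fun t _ => (gegenbauerP n j).hasDerivAt t)
    (fun t _ => (derivative (gegenbauerP n j)).hasDerivAt t)
  have h' : ∀ t : ℝ, ((1 - t ^ 2) * (derivative (derivative (gegenbauerP n j))).eval t
      - n * t * (derivative (gegenbauerP n j)).eval t) * (gegenbauerP n k).eval t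
      = -((j : ℝ) * (j + n - 1)) * ((gegenbauerP n j).eval t * (gegenbauerP n k).eval t) := by
    intro t
    linear_combination (gegenbauerP n k).eval t * gegenbauerP_ode_eval hn j t
  simp only [h', integral_const_mul] at h
  have h2 : ((j : ℝ) - k) * (j + k + n - 1) *
      ∫ t, (gegenbauerP n j).eval t * (gegenbauerP n k).eval t ∂gegenbauerMeasure n = 0 := by
    linear_combination -h
  refine (mul_eq_zero.mp h2).resolve_left (mul_ne_zero ?_ ?_)
  · exact sub_ne_zero.mpr (by exact_mod_cast hjk)
  · have : (1 : ℝ) ≤ j + k := by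
      have : 1 ≤ j + k := by omega
      exact_mod_cast this
    have hn' : (1 : ℝ) ≤ n := by exact_mod_cast hn
    linarith

theorem mul_integral_eval_of_eq {n : ℕ} (hn : 1 ≤ n) {p q r : ℝ[X]} {a b c : ℝ}
    (h : ∀ t : ℝ, a * p.eval t = b * q.eval t - c * r.eval t) :
    a * ∫ t, p.eval t ∂gegenbauerMeasure n
      = b * ∫ t, q.eval t ∂gegenbauerMeasure n - c * ∫ t, r.eval t ∂gegenbauerMeasure n := by
  simp only [← integral_const_mul]
  rw [← integral_sub ((integrable_eval_gegenbauerMeasure hn q).const_mul b)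
    ((integrable_eval_gegenbauerMeasure hn r).const_mul c)]
  simp only [h]

theorem gegenbauerP_add_two_eval {n : ℕ} (hn : 1 ≤ n) (k : ℕ) (t : ℝ) :
    ((k : ℝ) + n) * (gegenbauerP n (k + 2)).eval t =
      (2 * k + n + 1) * (t * (gegenbauerP n (k + 1)).eval t)
        - (k + 1) * (gegenbauerP n k).eval t := by
  have := congrArg (eval t) (gegenbauerP_add_two hn k)
  simp at this
  linear_combination this

/-- The three-term recurrence gives the ratio of consecutive norms `‖P_k‖²`, which is inverse to
the ratio of the dimensions. -/
theorem harmonicDim_mul_integral_gegenbauerP_sq {n : ℕ} (hn : 1 ≤ n) (k : ℕ) :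
    harmonicDim n k * ∫ t, (gegenbauerP n k).eval t ^ 2 ∂gegenbauerMeasure n
      = (gegenbauerMeasure n).real Set.univ := by
  have hn' : (1 : ℝ) ≤ n := by exact_mod_cast hn
  -- pairing the recurrence with `P_k`
  have hJ : ∀ k : ℕ, (2 * (k : ℝ) + n + 1) *
      ∫ t, t * (gegenbauerP n (k + 1)).eval t * (gegenbauerP n k).eval t ∂gegenbauerMeasure n
      = (k + 1) * ∫ t, (gegenbauerP n k).eval t ^ 2 ∂gegenbauerMeasure n := by
    intro k
    have h := mul_integral_eval_of_eq hn (p := gegenbauerP n (k + 2) * gegenbauerP n k)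
      (q := X * gegenbauerP n (k + 1) * gegenbauerP n k) (r := gegenbauerP n k ^ 2)
      (a := k + n) (b := 2 * k + n + 1) (c := k + 1) fun t => by
        simp only [eval_mul, eval_X, eval_pow]
        linear_combination (gegenbauerP n k).eval t * gegenbauerP_add_two_eval hn k t
    simp only [eval_mul, eval_X, eval_pow,
      integral_gegenbauerP_mul_of_ne hn (show k + 2 ≠ k by omega)] at h
    linear_combination -h
  -- pairing the recurrence with `P_{k+2}`
  have hJ' : ∀ k : ℕ, ((k : ℝ) + n) * ∫ t, (gegenbauerP n (k + 2)).eval t ^ 2 ∂gegenbauerMeasure n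
      = (2 * k + n + 1) * ∫ t, t * (gegenbauerP n (k + 2)).eval t * (gegenbauerP n (k + 1)).eval t
          ∂gegenbauerMeasure n := by
    intro k
    have h := mul_integral_eval_of_eq hn (p := gegenbauerP n (k + 2) ^ 2)
      (q := X * gegenbauerP n (k + 2) * gegenbauerP n (k + 1))
      (r := gegenbauerP n k * gegenbauerP n (k + 2))
      (a := k + n) (b := 2 * k + n + 1) (c := k + 1) fun t => by
        simp only [eval_mul, eval_X, eval_pow]
        linear_combination (gegenbauerP n (k + 2)).eval t * gegenbauerP_add_two_eval hn k t
    simp only [eval_mul, eval_X, eval_pow,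
      integral_gegenbauerP_mul_of_ne hn (show k ≠ k + 2 by omega)] at h
    linear_combination h
  have h0 : ∫ t, (gegenbauerP n 0).eval t ^ 2 ∂gegenbauerMeasure n
      = (gegenbauerMeasure n).real Set.univ := by simp [gegenbauerP_zero]
  induction k with
  | zero => rw [h0, harmonicDim, one_mul]
  | succ k ih =>
    rcases k with _ | k
    -- the ratio formula starts in degree one; here `t P_1 P_0 = P_1²` instead
    · have h := hJ 0
      rw [h0] at h
      simp [gegenbauerP_zero, gegenbauerP_one, harmonicDim] at h ⊢
      rw [← h]
      simp only [sq]
    · rw [← ih]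
      have h1 := hJ (k + 1)
      have h2 := hJ' k
      have h3 := harmonicDim_ratio n k
      have hk : (0 : ℝ) ≤ k := k.cast_nonneg
      have hne : ((k : ℝ) + n) * (2 * k + n + 3) * ((k + 2) * (2 * k + n + 1)) ≠ 0 := by positivity
      refine mul_left_cancel₀ hne ?_
      push_cast at h1
      set A := ∫ t, (gegenbauerP n (k + 1)).eval t ^ 2 ∂gegenbauerMeasure n
      set B := ∫ t, (gegenbauerP n (k + 1 + 1)).eval t ^ 2 ∂gegenbauerMeasure n
      set J := ∫ t, t * (gegenbauerP n (k + 1 + 1)).eval t * (gegenbauerP n (k + 1)).eval t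
          ∂gegenbauerMeasure n
      have hB : ((k : ℝ) + n) * B = (2 * k + n + 1) * J := h2
      have h3' : harmonicDim n (k + 1 + 1) * (((k : ℝ) + 2) * (2 * k + n + 1))
        = harmonicDim n (k + 1) * ((2 * k + n + 3) * (k + n)) := h3
      linear_combination ((k : ℝ) + n) * (2 * k + n + 3) * B * h3'
        + harmonicDim n (k + 1) * (2 * k + n + 3) ^ 2 * (k + n) * hB
        + harmonicDim n (k + 1) * (2 * k + n + 3) * (k + n) * (2 * k + n + 1) * h1

theorem harmonicDim_pos {n : ℕ} (hn : 1 ≤ n) (k : ℕ) : 0 < harmonicDim n k := by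
  refine pos_of_mul_pos_left ?_ (integral_nonneg (μ := gegenbauerMeasure n)
    fun t => sq_nonneg ((gegenbauerP n k).eval t))
  rw [harmonicDim_mul_integral_gegenbauerP_sq hn]
  exact gegenbauerMeasure_real_univ_pos hn

theorem sphereVol_pos (n : ℕ) : 0 < sphereVol n := by
  rw [sphereVol, Measure.toSphere_real_apply_univ]
  have := Metric.measure_ball_pos (volume : Measure (EuclideanSpace ℝ (Fin (n + 1)))) 0 one_pos
  have h : 0 < (volume : Measure (EuclideanSpace ℝ (Fin (n + 1)))).real (Metric.ball 0 1) :=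
    ENNReal.toReal_pos this.ne' measure_ball_lt_top.ne
  simp only [finrank_euclideanSpace, Fintype.card_fin]
  positivity

/-! ### Expansion coefficients and Bessel's inequality -/

theorem inner_toLp_two {μ : Measure ℝ} {f g : ℝ → ℝ} (hf : MemLp f 2 μ) (hg : MemLp g 2 μ) :
    inner ℝ (hf.toLp f) (hg.toLp g) = ∫ t, f t * g t ∂μ := by
  rw [L2.inner_def]
  refine integral_congr_ae ?_
  filter_upwards [hf.coeFn_toLp, hg.coeFn_toLp] with t h1 h2
  rw [h1, h2]
  exact mul_comm _ _

/-- Bessel's inequality for the orthonormal functions `√(α_k / μ_n([-1, 1])) P_k`. -/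
theorem summable_sq_integral_mul_harmonicDim {n : ℕ} (hn : 1 ≤ n) {f : ℝ → ℝ}
    (hf : ContinuousOn f (Set.Icc (-1) 1)) :
    Summable fun k => (∫ t, f t * (gegenbauerP n k).eval t ∂gegenbauerMeasure n) ^ 2
      * harmonicDim n k := by
  set M := (gegenbauerMeasure n).real Set.univ with hM
  have hM0 : 0 < M := gegenbauerMeasure_real_univ_pos hn
  have hmem : ∀ k, MemLp (fun t => √(harmonicDim n k / M) * (gegenbauerP n k).eval t) 2
      (gegenbauerMeasure n) := fun k =>
    ContinuousOn.memLp_gegenbauerMeasure hn (by fun_prop) 2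
  have hsq : ∀ k, √(harmonicDim n k / M) * √(harmonicDim n k / M) = harmonicDim n k / M :=
    fun k => Real.mul_self_sqrt (div_pos (harmonicDim_pos hn k) hM0).le
  have horth : Orthonormal ℝ fun k => (hmem k).toLp _ := by
    rw [orthonormal_iff_ite]
    intro j k
    rw [inner_toLp_two]
    have e : ∀ t, √(harmonicDim n j / M) * (gegenbauerP n j).eval t
        * (√(harmonicDim n k / M) * (gegenbauerP n k).eval t)
        = √(harmonicDim n j / M) * √(harmonicDim n k / M)
          * ((gegenbauerP n j).eval t * (gegenbauerP n k).eval t) := fun t => by ring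
    simp only [e, integral_const_mul]
    split_ifs with h
    · subst h
      have h1 := harmonicDim_mul_integral_gegenbauerP_sq hn j
      simp only [sq] at h1
      rw [hsq, div_mul_eq_mul_div, h1]
      exact div_self hM0.ne'
    · rw [integral_gegenbauerP_mul_of_ne hn h, mul_zero]
  have hsum := (horth.inner_products_summable
    (x := (hf.memLp_gegenbauerMeasure hn 2).toLp f)).mul_left M
  refine hsum.congr fun k => ?_
  rw [inner_toLp_two, Real.norm_eq_abs, sq_abs]
  have e : ∀ t, √(harmonicDim n k / M) * (gegenbauerP n k).eval t * f t
      = √(harmonicDim n k / M) * (f t * (gegenbauerP n k).eval t) := fun t => by ring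
  simp only [e, integral_const_mul]
  rw [mul_pow, sq √(harmonicDim n k / M), hsq]
  field_simp

/-- The coefficients of an `L²(μ_n)`-convergent expansion are recovered by integration. -/
theorem integral_mul_gegenbauerP_eq {n : ℕ} (hn : 1 ≤ n) {θ : ℝ → ℝ} {a : ℕ → ℝ}
    (hθ : ContinuousOn θ (Set.Icc (-1) 1))
    (ha : Tendsto
      (fun K : ℕ => eLpNorm
        (fun t => θ t - ∑ k ∈ Finset.range (K + 1), a k * (gegenbauerPhi n k).eval t)
        2 (gegenbauerMeasure n))
      atTop (𝓝 0)) (j : ℕ) :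
    ∫ t, θ t * (gegenbauerP n j).eval t ∂gegenbauerMeasure n
      = a j * ((gegenbauerMeasure n).real Set.univ / sphereVol n) := by
  have hθm := hθ.memLp_gegenbauerMeasure hn 2
  have hSm : ∀ K : ℕ, MemLp
      (fun t => ∑ k ∈ Finset.range (K + 1), a k * (gegenbauerPhi n k).eval t) 2
      (gegenbauerMeasure n) := fun K =>
    ContinuousOn.memLp_gegenbauerMeasure hn (by fun_prop) 2
  have hPm := (gegenbauerP n j).continuousOn.memLp_gegenbauerMeasure hn 2
  have hlim : Tendsto (fun K => (hSm K).toLp _) atTop (𝓝 (hθm.toLp θ)) := by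
    rw [Lp.tendsto_Lp_iff_tendsto_eLpNorm'']
    refine ha.congr fun K => ?_
    rw [eLpNorm_sub_comm]
    rfl
  have hinner := hlim.inner (𝕜 := ℝ) (tendsto_const_nhds (x := hPm.toLp _))
  simp only [inner_toLp_two] at hinner
  refine tendsto_nhds_unique hinner (tendsto_const_nhds.congr' ?_)
  filter_upwards [eventually_ge_atTop j] with K hK
  have hint : ∀ k, Integrable
      (fun t => a k * (gegenbauerPhi n k).eval t * (gegenbauerP n j).eval t)
      (gegenbauerMeasure n) := fun k =>
    memLp_one_iff_integrable.mp (ContinuousOn.memLp_gegenbauerMeasure hn (by fun_prop) 1)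
  simp only [Finset.sum_mul]
  rw [integral_finsetSum _ fun k _ => hint k, Finset.sum_eq_single j]
  · have h1 := harmonicDim_mul_integral_gegenbauerP_sq hn j
    have e : ∀ t, a j * (gegenbauerPhi n j).eval t * (gegenbauerP n j).eval t
        = a j * (harmonicDim n j / sphereVol n) * (gegenbauerP n j).eval t ^ 2 := fun t => by
      simp only [gegenbauerPhi, eval_mul, eval_C]; ring
    simp only [e, integral_const_mul, ← h1]
    ring
  · intro k _ hk
    have e : ∀ t, a k * (gegenbauerPhi n k).eval t * (gegenbauerP n j).eval t
        = a k * (harmonicDim n k / sphereVol n)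
          * ((gegenbauerP n k).eval t * (gegenbauerP n j).eval t) := fun t => by
      simp only [gegenbauerPhi, eval_mul, eval_C]; ring
    simp only [e, integral_const_mul, integral_gegenbauerP_mul_of_ne hn hk, mul_zero]
  · intro h
    exact absurd (Finset.mem_range.mpr (by omega)) h

/-- Bessel's inequality for `θ` and for `L θ`; the latter has coefficients
`-k (k + n - 1) a_k` and gains the square of the eigenvalue. -/
theorem summable_sq_mul_harmonicDim_mul_eigenvalue {n : ℕ} (hn : 1 ≤ n) {θ : ℝ → ℝ} {a : ℕ → ℝ}
    (hθ : ContDiffOn ℝ 2 θ (Set.Icc (-1) 1))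
    (ha : Tendsto
      (fun K : ℕ => eLpNorm
        (fun t => θ t - ∑ k ∈ Finset.range (K + 1), a k * (gegenbauerPhi n k).eval t)
        2 (gegenbauerMeasure n))
      atTop (𝓝 0)) :
    Summable fun k : ℕ =>
      a k ^ 2 * (harmonicDim n k / sphereVol n) * (1 + ((k : ℝ) * (k + n - 1)) ^ 2) := by
  have hV := sphereVol_pos n
  have hM := gegenbauerMeasure_real_univ_pos hn
  have hU : UniqueDiffOn ℝ (Set.Icc (-1 : ℝ) 1) := uniqueDiffOn_Icc (by norm_num)
  set θ' := derivWithin θ (Set.Icc (-1) 1) with hθ'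
  set θ'' := derivWithin θ' (Set.Icc (-1) 1) with hθ''
  have hc1 : ContDiffOn ℝ 1 θ' (Set.Icc (-1) 1) := hθ.derivWithin hU (by norm_num)
  have hc0 : ContDiffOn ℝ 0 θ'' (Set.Icc (-1) 1) := hc1.derivWithin hU (by norm_num)
  have hd : ∀ {f : ℝ → ℝ}, DifferentiableOn ℝ f (Set.Icc (-1) 1) → ∀ t ∈ Set.Ioo (-1 : ℝ) 1,
      HasDerivAt f (derivWithin f (Set.Icc (-1) 1) t) t := fun hf t ht =>
    ((hf t (Set.Ioo_subset_Icc_self ht)).hasDerivWithinAt).hasDerivAt (Icc_mem_nhds ht.1 ht.2)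
  have hθ0 := hθ.continuousOn
  have hθ1 := hc1.continuousOn
  have hθ2 := hc0.continuousOn
  have hL : ContinuousOn (fun t => (1 - t ^ 2) * θ'' t - n * t * θ' t) (Set.Icc (-1) 1) := by
    fun_prop
  have hs := (summable_sq_integral_mul_harmonicDim hn hθ0).add
    (summable_sq_integral_mul_harmonicDim hn hL)
  refine (hs.mul_left (sphereVol n / (gegenbauerMeasure n).real Set.univ ^ 2)).congr fun k => ?_
  rw [integral_gegenbauerOp_mul_gegenbauerP hn k hθ0 hθ1 hθ2
    (hd (hθ.differentiableOn (by norm_num))) (hd (hc1.differentiableOn (by norm_num))),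
    integral_mul_gegenbauerP_eq hn hθ0 ha]
  field_simp

/-! ### Uniformly convergent series -/

/-- Uniform convergence implies convergence in `L²(μ_n)`, because `μ_n` is finite. -/
theorem tendsto_eLpNorm_tsum_sub_sum {n : ℕ} (hn : 1 ≤ n) {f : ℕ → ℝ → ℝ} {u : ℕ → ℝ}
    (hu : Summable u) (hfu : ∀ k, ∀ t ∈ Set.Icc (-1 : ℝ) 1, ‖f k t‖ ≤ u k) :
    Tendsto (fun K : ℕ => eLpNorm (fun t => ∑' k, f k t - ∑ k ∈ Finset.range (K + 1), f k t)
      2 (gegenbauerMeasure n)) atTop (𝓝 0) := by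
  have := isFiniteMeasure_gegenbauerMeasure hn
  have htail : Tendsto (fun K : ℕ => ∑' k, u (k + (K + 1))) atTop (𝓝 0) :=
    (tendsto_sum_nat_add u).comp (tendsto_add_atTop_nat 1)
  have hbound : Tendsto (fun K : ℕ => gegenbauerMeasure n Set.univ ^ (2 : ENNReal).toReal⁻¹ *
      ENNReal.ofReal (∑' k, u (k + (K + 1)))) atTop (𝓝 0) := by
    have h1 := ENNReal.tendsto_ofReal htail
    rw [ENNReal.ofReal_zero] at h1
    have h2 := ENNReal.Tendsto.const_mul
      (a := gegenbauerMeasure n Set.univ ^ (2 : ENNReal).toReal⁻¹)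
      h1 (Or.inr (ENNReal.rpow_ne_top_of_nonneg (by positivity) (measure_ne_top _ _)))
    simpa using h2
  refine tendsto_of_tendsto_of_tendsto_of_le_of_le tendsto_const_nhds hbound
    (fun _ => zero_le) fun K => eLpNorm_le_of_ae_bound ?_
  filter_upwards [ae_mem_Icc_gegenbauerMeasure n] with t ht
  have hsum : Summable fun k => f k t := hu.of_norm_bounded fun k => hfu k t ht
  rw [← hsum.sum_add_tsum_nat_add (K + 1), add_sub_cancel_left]
  exact tsum_of_norm_bounded ((summable_nat_add_iff (K + 1)).mpr hu).hasSum fun k => hfu _ t ht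

/-- Term-by-term differentiation on a compact interval, one-sided at its endpoints. -/
theorem hasDerivWithinAt_tsum_Icc {f f' : ℕ → ℝ → ℝ} {u v : ℕ → ℝ} {b c : ℝ} (hbc : b < c)
    (hu : Summable u) (hv : Summable v)
    (hfu : ∀ k, ∀ t ∈ Set.Icc b c, ‖f k t‖ ≤ u k) (hfv : ∀ k, ∀ t ∈ Set.Icc b c, ‖f' k t‖ ≤ v k)
    (hd : ∀ k t, HasDerivAt (f k) (f' k t) t) (hc' : ∀ k, ContinuousOn (f' k) (Set.Icc b c))
    {t : ℝ} (ht : t ∈ Set.Icc b c) :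
    HasDerivWithinAt (fun s => ∑' k, f k s) (∑' k, f' k t) (Set.Icc b c) t := by
  have hg : ContinuousOn (fun s => ∑' k, f k s) (Set.Icc b c) :=
    continuousOn_tsum (fun k s _ => (hd k s).continuousAt.continuousWithinAt) hu hfu
  have hh : ContinuousOn (fun s => ∑' k, f' k s) (Set.Icc b c) := continuousOn_tsum hc' hv hfv
  have hint : ∀ s ∈ Set.Ioo b c,
      HasDerivAt (fun s => ∑' k, f k s) (∑' k, f' k s) s := fun s hs =>
    hasDerivAt_tsum_of_isPreconnected hv isOpen_Ioo isPreconnected_Ioo (fun k y _ => hd k y)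
      (fun k y hy => hfv k y (Set.Ioo_subset_Icc_self hy)) hs
      (hu.of_norm_bounded fun k => hfu k s (Set.Ioo_subset_Icc_self hs)) hs
  have hdiff : DifferentiableOn ℝ (fun s => ∑' k, f k s) (Set.Ioo b c) := fun s hs =>
    (hint s hs).differentiableAt.differentiableWithinAt
  rcases eq_or_lt_of_le ht.1 with rfl | h1
  · have hmem : Set.Ioo b c ∈ 𝓝[>] b := Ioo_mem_nhdsGT hbc
    refine (hasDerivWithinAt_Ici_of_tendsto_deriv hdiff
      ((hg b ht).mono Set.Ioo_subset_Icc_self) hmem ?_).mono Set.Icc_subset_Ici_self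
    have h2 : Tendsto (fun s => ∑' k, f' k s) (𝓝[>] b) (𝓝 (∑' k, f' k b)) := by
      rw [← nhdsWithin_Ioo_eq_nhdsGT hbc]
      exact (hh b ht).mono Set.Ioo_subset_Icc_self
    exact h2.congr' (by filter_upwards [hmem] with s hs using (hint s hs).deriv.symm)
  rcases eq_or_lt_of_le ht.2 with rfl | h2
  · have hmem : Set.Ioo b t ∈ 𝓝[<] t := Ioo_mem_nhdsLT hbc
    refine (hasDerivWithinAt_Iic_of_tendsto_deriv hdiff
      ((hg t ht).mono Set.Ioo_subset_Icc_self) hmem ?_).mono Set.Icc_subset_Iic_self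
    have h2 : Tendsto (fun s => ∑' k, f' k s) (𝓝[<] t) (𝓝 (∑' k, f' k t)) := by
      rw [← nhdsWithin_Ioo_eq_nhdsLT hbc]
      exact (hh t ht).mono Set.Ioo_subset_Icc_self
    exact h2.congr' (by filter_upwards [hmem] with s hs using (hint s hs).deriv.symm)
  · exact (hint t ⟨h1, h2⟩).hasDerivWithinAt

/-! ### The series `g` and `h` -/

theorem mainTheorem3 (n : ℕ) (hn : 1 ≤ n) (θ : ℝ → ℝ) (a : ℕ → ℝ)
    (hθ : ContDiffOn ℝ 2 θ (Set.Icc (-1) 1))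
    (ha : Tendsto
      (fun K : ℕ => eLpNorm
        (fun t => θ t - ∑ k ∈ Finset.range (K + 1), a k * (gegenbauerPhi n k).eval t)
        2 (gegenbauerMeasure n))
      atTop (𝓝 0)) :
    (∀ t ∈ Set.Icc (-1 : ℝ) 1,
      Summable (fun k : ℕ => |a k ^ 2 * (gegenbauerPhi n k).eval t|) ∧
      Tendsto (fun K : ℕ => ∑ k ∈ Finset.range (K + 1), a k ^ 2 * (gegenbauerPhi n k).eval t)
        atTop (𝓝 (gTheta n a t))) ∧
    Tendsto
      (fun K : ℕ => eLpNorm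
        (fun t => gTheta n a t -
          ∑ k ∈ Finset.range (K + 1), a k ^ 2 * (gegenbauerPhi n k).eval t)
        2 (gegenbauerMeasure n))
      atTop (𝓝 0) ∧
    (∀ t ∈ Set.Icc (-1 : ℝ) 1,
      Summable (fun k : ℕ => |a k ^ 2 * (derivative (gegenbauerPhi n k)).eval t|) ∧
      Tendsto
        (fun K : ℕ => ∑ k ∈ Finset.range (K + 1),
          a k ^ 2 * (derivative (gegenbauerPhi n k)).eval t)
        atTop (𝓝 (hTheta n a t))) ∧
    Tendsto
      (fun K : ℕ => eLpNorm
        (fun t => hTheta n a t -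
          ∑ k ∈ Finset.range (K + 1), a k ^ 2 * (derivative (gegenbauerPhi n k)).eval t)
        2 (gegenbauerMeasure n))
      atTop (𝓝 0) ∧
    (ContDiffOn ℝ 4 θ (Set.Icc (-1) 1) →
      ∀ t ∈ Set.Icc (-1 : ℝ) 1,
        HasDerivWithinAt (gTheta n a) (hTheta n a t) (Set.Icc (-1) 1) t) := by
  have hV := sphereVol_pos n
  have hn' : (1 : ℝ) ≤ n := by exact_mod_cast hn
  -- Since `φ_{n,k}(1) = α_{n,k} / vol(S^n)`, this one series dominates both `a_k² |φ_{n,k}|` and,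
  -- as `λ ≤ 1 + λ²`, also `a_k² |φ_{n,k}'| ≤ a_k² φ_{n,k}(1) λ`.
  have hu := summable_sq_mul_harmonicDim_mul_eigenvalue hn hθ ha
  set u : ℕ → ℝ := fun k =>
    a k ^ 2 * (harmonicDim n k / sphereVol n) * (1 + ((k : ℝ) * (k + n - 1)) ^ 2) with hu_def
  have hα : ∀ k, 0 ≤ harmonicDim n k / sphereVol n := fun k =>
    (div_pos (harmonicDim_pos hn k) hV).le
  have hgu : ∀ k, ∀ t ∈ Set.Icc (-1 : ℝ) 1, ‖a k ^ 2 * (gegenbauerPhi n k).eval t‖ ≤ u k := by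
    intro k t ht
    rw [gegenbauerPhi, eval_mul, eval_C, ← mul_assoc, norm_mul,
      Real.norm_of_nonneg (mul_nonneg (sq_nonneg _) (hα k)), Real.norm_eq_abs]
    refine mul_le_mul_of_nonneg_left ?_ (mul_nonneg (sq_nonneg _) (hα k))
    exact (abs_gegenbauerP_le_one hn k ht).trans (le_add_of_nonneg_right (sq_nonneg _))
  have hhu : ∀ k, ∀ t ∈ Set.Icc (-1 : ℝ) 1,
      ‖a k ^ 2 * (derivative (gegenbauerPhi n k)).eval t‖ ≤ u k := by
    intro k t ht
    rw [gegenbauerPhi, derivative_C_mul, eval_mul, eval_C, ← mul_assoc, norm_mul,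
      Real.norm_of_nonneg (mul_nonneg (sq_nonneg _) (hα k)), Real.norm_eq_abs]
    refine mul_le_mul_of_nonneg_left ?_ (mul_nonneg (sq_nonneg _) (hα k))
    refine (abs_derivative_gegenbauerP_le hn k ht).trans ?_
    have hk : (0 : ℝ) ≤ k := k.cast_nonneg
    have hlam : 0 ≤ (k : ℝ) * (k + n - 1) := mul_nonneg hk (by linarith)
    refine (div_le_self hlam hn').trans ?_
    nlinarith [sq_nonneg ((k : ℝ) * (k + n - 1) - 1)]
  have hlim : ∀ {f : ℕ → ℝ}, (∀ k, ‖f k‖ ≤ u k) → Summable (fun k => |f k|) ∧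
      Tendsto (fun K : ℕ => ∑ k ∈ Finset.range (K + 1), f k) atTop (𝓝 (∑' k, f k)) := by
    intro f hf
    exact ⟨hu.of_nonneg_of_le (fun k => abs_nonneg _) hf,
      (hu.of_norm_bounded hf).hasSum.tendsto_sum_nat.comp (tendsto_add_atTop_nat 1)⟩
  refine ⟨fun t ht => hlim fun k => hgu k t ht, tendsto_eLpNorm_tsum_sub_sum hn hu hgu,
    fun t ht => hlim fun k => hhu k t ht, tendsto_eLpNorm_tsum_sub_sum hn hu hhu, fun _ t ht => ?_⟩
  exact hasDerivWithinAt_tsum_Icc (by norm_num) hu hu hgu hhu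
    (fun k s => ((gegenbauerPhi n k).hasDerivAt s).const_mul _)
    (fun k => by fun_prop) ht
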